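/- Let $T$ be a random tournament on the vertex set $\mathbb{Z}^+=\{1,2,3,\dots\}$: for each pair of distinct vertices $u,v$, exactly one of the arcs $u\to v$, $v\to u$ is present, each with probability $1/2$, independently for distinct pairs. For $n\ge 1$ let $T_n$ be the subtournament of $T$ induced on $\{1,\dots,n\}$. For a vertex $u$ of a digraph let $N_i(u)$ be the set of vertices $v$ such that the shortest directed path from $u$ to $v$ has length $i$; $u$ is called a Seymour vertex if $|N_2(u)|\ge |N_1(u)|$. Let $S_n$ be the number of Seymour vertices of $T_n$. Then for each $\varepsilon>0$, $$\mathbb{P}\bigl(|S_n-\mathbb{E}(S_n)|>n^{0.5+\varepsilon}\ \text{for infinitely many } n\bigr)=0.$$ -/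

import Mathlib

open MeasureTheory ProbabilityTheory Filter

namespace SeymourTournament

/-- There is a directed path (with pairwise distinct vertices) with `k` arcs from `u` to `v`. -/
def HasPathOfLength {V : Type*} (D : Digraph V) (u v : V) (k : ℕ) : Prop :=
  ∃ p : Fin (k + 1) → V, Function.Injective p ∧ p 0 = u ∧ p (Fin.last k) = v ∧
    ∀ i : Fin k, D.Adj (p i.castSucc) (p i.succ)

/-- The length of the shortest directed path from `u` to `v`, and `⊤` if there is none. -/
noncomputable def dist {V : Type*} (D : Digraph V) (u v : V) : ℕ∞ :=
  ⨅ (k : ℕ) (_ : HasPathOfLength D u v k), (k : ℕ∞)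

/-- `N_i(u)`: the set of vertices at distance exactly `i` from `u`. -/
def nbhd {V : Type*} (D : Digraph V) (i : ℕ) (u : V) : Set V :=
  {v | dist D u v = (i : ℕ∞)}

/-- A Seymour vertex: `|N_2(v)| ≥ |N_1(v)|`. -/
def IsSeymour {V : Type*} (D : Digraph V) (v : V) : Prop :=
  (nbhd D 1 v).encard ≤ (nbhd D 2 v).encard

/-- A tournament: no loops, and exactly one of the arcs `u → v`, `v → u` for each pair of
distinct vertices. -/
def IsTournament {V : Type*} (D : Digraph V) : Prop :=
  (∀ v, ¬ D.Adj v v) ∧ ∀ u v, u ≠ v → (D.Adj u v ↔ ¬ D.Adj v u)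

/-- The subdigraph induced on the first `n` vertices `{1, …, n}` of `ℤ⁺`. -/
def firstVertices (D : Digraph ℕ+) (n : ℕ) : Digraph {v : ℕ+ // (v : ℕ) ≤ n} where
  Adj u v := D.Adj u v

/-- `S_n`: the number of Seymour vertices of the subdigraph induced on `{1, …, n}`. -/
noncomputable def seymourCount (D : Digraph ℕ+) (n : ℕ) : ℕ :=
  {v : {v : ℕ+ // (v : ℕ) ≤ n} | IsSeymour (firstVertices D n) v}.ncard

/-- `T` is a random tournament on `ℤ⁺`: the orientations of the edges are independent, each of
the two orientations of an edge having probability `1/2`. -/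
structure IsRandomTournament {Ω : Type*} [MeasurableSpace Ω] (P : Measure Ω)
    (T : Ω → Digraph ℕ+) : Prop where
  isTournament : ∀ ω, IsTournament (T ω)
  measurableSet_adj : ∀ u v : ℕ+, MeasurableSet {ω | (T ω).Adj u v}
  prob_adj : ∀ u v : ℕ+, u ≠ v → P {ω | (T ω).Adj u v} = 1 / 2
  indep : iIndepSet
    (fun e : {e : ℕ+ × ℕ+ // e.1 < e.2} => {ω | (T ω).Adj e.1.1 e.1.2}) P

end SeymourTournament

/-! Off an event of exponentially small probability, any two distinct vertices of $T_n$ are joined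
by a path of length two. Then $N_2(u)$ consists of all in-neighbours of $u$, so $u$ is Seymour
exactly when its out-degree is at most $(n-1)/2$. It therefore suffices to concentrate the number of
low-degree vertices (`seymourCount_eq_of_not_hasFarPair`).

That number is a sum over the rows of the adjacency matrix. The rows are dependent only because the
entries $(u,v)$ and $(v,u)$ are opposite bits. Being of low degree is antitone in the row, so for
each $t$ the factors of the exponential moment are all antitone or all monotone. For such factors,
replacing opposite bits by independent ones can only increase the mean of the product
(`sum_prod_glue_le`). Hoeffding's argument then applies as if the rows were independent: the centred
count is sub-Gaussian with variance proxy $n$ (`hasSubgaussianMGF_lowDegreeCount`).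

At scale $n^{1/2+\varepsilon}$ the tails are of order $\exp(-n^{2\varepsilon}/8)$, plus the
exponentially small error. They are summable, and Borel–Cantelli concludes. -/

namespace SeymourTournament

/-! ### Distances and Seymour vertices in diameter at most two -/

section Distance

variable {V : Type*} {D : Digraph V} {u v : V}

theorem hasPathOfLength_zero : HasPathOfLength D u v 0 ↔ u = v := by
  constructor
  · rintro ⟨p, -, h0, h1, -⟩
    rw [← h0, ← h1]; rfl
  · rintro rfl
    exact ⟨fun _ => u, fun i j _ => Subsingleton.elim (α := Fin 1) i j, rfl, rfl, fun i => i.elim0⟩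

theorem hasPathOfLength_one : HasPathOfLength D u v 1 ↔ u ≠ v ∧ D.Adj u v := by
  constructor
  · rintro ⟨p, hp, rfl, rfl, h⟩
    exact ⟨fun e => absurd (hp e) (by decide), h 0⟩
  · rintro ⟨hne, h⟩
    refine ⟨![u, v], ?_, rfl, rfl, ?_⟩
    · intro i j
      fin_cases i <;> fin_cases j <;> simp [hne, hne.symm]
    · intro i
      fin_cases i
      simpa using h

theorem hasPathOfLength_two_of_adj {w : V} (h1 : D.Adj u w) (h2 : D.Adj w v) (huw : u ≠ w)
    (hwv : w ≠ v) (huv : u ≠ v) : HasPathOfLength D u v 2 := by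
  refine ⟨![u, w, v], ?_, rfl, rfl, ?_⟩
  · intro i j
    fin_cases i <;> fin_cases j <;> simp [huw, hwv, huv, huw.symm, hwv.symm, huv.symm]
  · intro i
    fin_cases i
    · simpa using h1
    · simpa using h2

theorem dist_le_of_hasPathOfLength {k : ℕ} (h : HasPathOfLength D u v k) :
    dist D u v ≤ k :=
  iInf₂_le k h

theorem le_dist {k : ℕ} (h : ∀ j < k, ¬ HasPathOfLength D u v j) : (k : ℕ∞) ≤ dist D u v := by
  refine le_iInf₂ fun j hj => ?_
  by_contra hlt
  exact h j (by exact_mod_cast not_le.mp hlt) hj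

theorem dist_eq_one_iff (hirr : ∀ v, ¬ D.Adj v v) : dist D u v = 1 ↔ D.Adj u v := by
  have key : D.Adj u v → dist D u v = 1 := fun h => by
    have hne : u ≠ v := fun e => hirr v (e ▸ h)
    refine le_antisymm ?_ ?_
    · simpa using dist_le_of_hasPathOfLength (hasPathOfLength_one.2 ⟨hne, h⟩)
    · have := le_dist (D := D) (u := u) (v := v) (k := 1) (by
        intro j hj
        obtain rfl : j = 0 := by omega
        rw [hasPathOfLength_zero]
        exact hne)
      simpa using this
  refine ⟨fun h => ?_, key⟩
  by_contra hadj
  by_cases hne : u = v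
  · have := dist_le_of_hasPathOfLength (D := D) (hasPathOfLength_zero.2 hne)
    rw [h] at this
    simp at this
  · have := le_dist (D := D) (u := u) (v := v) (k := 2) (by
      intro j hj
      interval_cases j
      · rwa [hasPathOfLength_zero]
      · rw [hasPathOfLength_one]
        exact fun e => hadj e.2)
    rw [h] at this
    exact absurd this (by decide)

theorem dist_eq_two_iff (hirr : ∀ v, ¬ D.Adj v v)
    (hdiam : ∀ u v, u ≠ v → D.Adj u v ∨ ∃ w, D.Adj u w ∧ D.Adj w v) :
    dist D u v = 2 ↔ u ≠ v ∧ ¬ D.Adj u v := by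
  constructor
  · intro h
    refine ⟨fun e => ?_, fun e => ?_⟩
    · have := dist_le_of_hasPathOfLength (D := D) (hasPathOfLength_zero.2 e)
      rw [h] at this
      simp at this
    · rw [(dist_eq_one_iff hirr).2 e] at h
      exact absurd h (by decide)
  · rintro ⟨hne, hadj⟩
    obtain ⟨w, h1, h2⟩ := (hdiam u v hne).resolve_left hadj
    refine le_antisymm ?_ ?_
    · have := dist_le_of_hasPathOfLength (hasPathOfLength_two_of_adj h1 h2
        (fun e => hirr w (e ▸ h1)) (fun e => hirr v (e ▸ h2)) hne)
      simpa using this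
    · have := le_dist (D := D) (u := u) (v := v) (k := 2) (by
        intro j hj
        interval_cases j
        · rwa [hasPathOfLength_zero]
        · rw [hasPathOfLength_one]
          exact fun e => hadj e.2)
      simpa using this

/-- In a loopless digraph of diameter at most two, a vertex is a Seymour vertex exactly when it
dominates at most half of the other vertices. -/
theorem isSeymour_iff_of_diam_le_two [Finite V] (hirr : ∀ v, ¬ D.Adj v v)
    (hdiam : ∀ u v, u ≠ v → D.Adj u v ∨ ∃ w, D.Adj u w ∧ D.Adj w v) :
    IsSeymour D u ↔ 2 * {v | D.Adj u v}.ncard + 1 ≤ Nat.card V := by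
  have h1 : nbhd D 1 u = {v | D.Adj u v} := by
    ext v
    simpa [nbhd] using dist_eq_one_iff hirr
  -- Everything outside `u` and its out-neighbourhood is at distance two, so the Seymour condition
  -- becomes a bound on the out-degree alone.
  have h2 : nbhd D 2 u = ({v | D.Adj u v} ∪ {u})ᶜ := by
    ext v
    have := dist_eq_two_iff (u := u) (v := v) hirr hdiam
    simp only [nbhd, Nat.cast_ofNat, Set.mem_ofPred_eq, this, Set.mem_compl_iff, Set.mem_union,
      Set.mem_singleton_iff, not_or]
    exact ⟨fun h => ⟨h.2, Ne.symm h.1⟩, fun h => ⟨Ne.symm h.2, h.1⟩⟩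
  have h3 : ({v | D.Adj u v} ∪ {u}).ncard = {v | D.Adj u v}.ncard + 1 := by
    rw [Set.union_singleton, Set.ncard_insert_of_notMem (by simpa using hirr u)]
  have h4 := Set.ncard_add_ncard_compl ({v | D.Adj u v} ∪ {u})
  rw [IsSeymour, h1, h2, ← (Set.toFinite _).cast_ncard_eq, ← (Set.toFinite _).cast_ncard_eq,
    Nat.cast_le]
  omega

end Distance

/-! ### Decoupling opposite bits by rearrangement -/

section Decoupling

variable {V : Type*} [LinearOrder V]

/-- The matrix of the bits `y`, with the entry `(u, v)` replaced by the negation of the opposite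
bit when `(v, u)` belongs to `E`. -/
def glue (E : Finset (V × V)) (y : V × V → Bool) (u v : V) : Bool :=
  if (v, u) ∈ E then !y (v, u) else y (u, v)

/-- Negate the bits `(a, b)` and `(b, a)`. -/
def flipPair (a b : V) (y : V × V → Bool) (e : V × V) : Bool :=
  if e = (a, b) ∨ e = (b, a) then !y e else y e

theorem flipPair_involutive (a b : V) : Function.Involutive (flipPair a b) := by
  intro y
  funext e
  by_cases h : e = (a, b) ∨ e = (b, a) <;> simp [flipPair, h]

/-- The two-point rearrangement inequality: pairing opposite values of similarly ordered functions
gives the smaller sum. If `t = !s` both sides agree. -/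
theorem mul_add_mul_le_of_comonotone {g h : Bool → ℝ}
    (hgh : (Monotone g ∧ Monotone h) ∨ (Antitone g ∧ Antitone h)) (s t : Bool) :
    g s * h (!s) + g (!s) * h s ≤ g s * h t + g (!s) * h (!t) := by
  have hft : false ≤ true := by decide
  have key : 0 ≤ (g true - g false) * (h true - h false) := by
    rcases hgh with ⟨hg, hh⟩ | ⟨hg, hh⟩
    · exact mul_nonneg (sub_nonneg.2 (hg hft)) (sub_nonneg.2 (hh hft))
    · exact mul_nonneg_of_nonpos_of_nonpos (sub_nonpos.2 (hg hft)) (sub_nonpos.2 (hh hft))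
  cases s <;> cases t <;> simp <;> linarith

variable [Fintype V]

/-- One decoupling step. Only row `b` changes, reading `!y (a, b)` instead of the independent bit `y
(b, a)`. Adding the term with both bits flipped reduces the claim to rearrangement in rows `a` and
`b`, the other rows giving a common nonnegative factor. -/
theorem prod_glue_insert_le {f : V → (V → Bool) → ℝ} (hf0 : ∀ u r, 0 ≤ f u r)
    (hf : (∀ u, Monotone (f u)) ∨ ∀ u, Antitone (f u)) {E : Finset (V × V)}
    (hE : ∀ p ∈ E, p.1 < p.2) {a b : V} (hab : a < b) (hmem : (a, b) ∉ E) (y : V × V → Bool) :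
    ∏ u, f u (glue (insert (a, b) E) y u) + ∏ u, f u (glue (insert (a, b) E) (flipPair a b y) u) ≤
      ∏ u, f u (glue E y u) + ∏ u, f u (glue E (flipPair a b y) u) := by
  have hne : a ≠ b := hab.ne
  have hba : (b, a) ∉ E := fun h => lt_asymm hab (hE _ h)
  -- Rows `a` and `b` as functions of the one bit at stake, all other bits being frozen.
  set ra : Bool → V → Bool := fun s => Function.update (glue E y a) b s with hra
  set rb : Bool → V → Bool := fun s => Function.update (glue E y b) a s with hrb
  have a1 : glue E y a = ra (y (a, b)) := by
    simp [hra, glue, hba]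
  have b1 : glue E y b = rb (y (b, a)) := by
    simp [hrb, glue, hmem]
  have a2 : glue E (flipPair a b y) a = ra (!y (a, b)) := by
    funext v
    by_cases hv : v = b
    · subst hv; simp [hra, glue, hba, flipPair]
    · by_cases hva : v = a <;> simp [hra, glue, flipPair, hv, hne, hva]
  have b2 : glue E (flipPair a b y) b = rb (!y (b, a)) := by
    funext v
    by_cases hv : v = a
    · subst hv; simp [hrb, glue, hmem, flipPair]
    · by_cases hva : v = b <;> simp [hrb, glue, flipPair, hv, hne.symm, hva]
  have a3 : ∀ z, glue (insert (a, b) E) z a = glue E z a := by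
    intro z; funext v
    simp [glue, hne]
  have b3 : ∀ z, glue (insert (a, b) E) z b = Function.update (glue E z b) a (!z (a, b)) := by
    intro z; funext v
    by_cases hv : v = a
    · subst hv; simp [glue]
    · simp [glue, hv]
  have b4 : glue (insert (a, b) E) y b = rb (!y (a, b)) := b3 y
  have b5 : glue (insert (a, b) E) (flipPair a b y) b = rb (y (a, b)) := by
    rw [b3, b2]; simp [hrb, flipPair]
  have c3 : ∀ z u, u ≠ b → glue (insert (a, b) E) z u = glue E z u := by
    intro z u hu; funext v
    simp [glue, hu]
  have c2 : ∀ u, u ≠ a → u ≠ b → glue E (flipPair a b y) u = glue E y u := by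
    intro u hua hub; funext v
    simp [glue, flipPair, hua, hub]
  have split : ∀ F : V → ℝ,
      ∏ u, F u = (∏ u ∈ (Finset.univ.erase a).erase b, F u) * (F a * F b) := by
    intro F
    rw [← Finset.mul_prod_erase _ F (Finset.mem_univ a),
      ← Finset.mul_prod_erase (Finset.univ.erase a) F (a := b) (by simp [hne.symm])]
    ring
  set C := ∏ u ∈ (Finset.univ.erase a).erase b, f u (glue E y u) with hC
  have hC0 : 0 ≤ C := Finset.prod_nonneg fun u _ => hf0 u _
  have e1 : ∏ u ∈ (Finset.univ.erase a).erase b, f u (glue (insert (a, b) E) y u) = C := by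
    refine Finset.prod_congr rfl fun u hu => ?_
    simp only [Finset.mem_erase] at hu
    rw [c3 _ _ hu.1]
  have e2 : ∏ u ∈ (Finset.univ.erase a).erase b,
      f u (glue (insert (a, b) E) (flipPair a b y) u) = C := by
    refine Finset.prod_congr rfl fun u hu => ?_
    simp only [Finset.mem_erase] at hu
    rw [c3 _ _ hu.1, c2 _ hu.2.1 hu.1]
  have e3 : ∏ u ∈ (Finset.univ.erase a).erase b, f u (glue E (flipPair a b y) u) = C := by
    refine Finset.prod_congr rfl fun u hu => ?_
    simp only [Finset.mem_erase] at hu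
    rw [c2 _ hu.2.1 hu.1]
  rw [split, split, split, split, e1, e2, e3, a3, a3, b4, b5, a1, a2, b2, b1, ← hC,
    ← mul_add, ← mul_add]
  refine mul_le_mul_of_nonneg_left ?_ hC0
  refine mul_add_mul_le_of_comonotone (g := fun s => f a (ra s)) (h := fun s => f b (rb s)) ?_ _ _
  have ma : Monotone ra := fun s t h => update_le_update_iff'.2 h
  have mb : Monotone rb := fun s t h => update_le_update_iff'.2 h
  rcases hf with hf | hf
  · exact Or.inl ⟨(hf a).comp ma, (hf b).comp mb⟩
  · exact Or.inr ⟨(hf a).comp_monotone ma, (hf b).comp_monotone mb⟩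

/-- Replacing independent bits by pairs of opposite bits decreases the mean of a product of
nonnegative comonotone functions of the rows. -/
theorem sum_prod_glue_le {f : V → (V → Bool) → ℝ} (hf0 : ∀ u r, 0 ≤ f u r)
    (hf : (∀ u, Monotone (f u)) ∨ ∀ u, Antitone (f u)) (E : Finset (V × V))
    (hE : ∀ p ∈ E, p.1 < p.2) :
    ∑ y : V × V → Bool, ∏ u, f u (glue E y u) ≤ ∏ u, ∑ r : V → Bool, f u r := by
  induction E using Finset.induction_on with
  | empty =>
    -- With no pair glued, the rows of `y` range independently over all rows, and equality holds.
    rw [Finset.prod_univ_sum, Fintype.piFinset_univ]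
    refine le_of_eq (Fintype.sum_equiv (Equiv.curry V V Bool) _ _ fun y => ?_)
    rfl
  | insert p E hp ih =>
    obtain ⟨a, b⟩ := p
    have hE' : ∀ p ∈ E, p.1 < p.2 := fun p h => hE p (Finset.mem_insert_of_mem h)
    refine le_trans ?_ (ih hE')
    -- The flip permutes the configurations, so summing the symmetrised inequality gives twice the
    -- desired one.
    have hsum : ∀ F : (V × V → Bool) → ℝ, ∑ y, F (flipPair a b y) = ∑ y, F y := fun F =>
      Equiv.sum_comp (flipPair_involutive a b).toPerm F
    have h := Finset.sum_le_sum fun y (_ : y ∈ (Finset.univ : Finset (V × V → Bool))) =>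
      prod_glue_insert_le hf0 hf hE' (hE _ (Finset.mem_insert_self _ _)) hp y
    rw [Finset.sum_add_distrib, Finset.sum_add_distrib,
      hsum fun y => ∏ u, f u (glue (insert (a, b) E) y u),
      hsum fun y => ∏ u, f u (glue E y u)] at h
    linarith

end Decoupling

/-! ### Probabilities of prescribed arcs and of missing two-paths -/

section Cylinder

variable {Ω : Type*} [MeasurableSpace Ω] {P : Measure Ω} {T : Ω → Digraph ℕ+}

theorem IsRandomTournament.prob_forall_adj_iff (hT : IsRandomTournament P T)
    (S : Finset {e : ℕ+ × ℕ+ // e.1 < e.2}) (b : {e : ℕ+ × ℕ+ // e.1 < e.2} → Prop) :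
    P.real {ω | ∀ e ∈ S, ((T ω).Adj e.1.1 e.1.2 ↔ b e)} = (1 / 2) ^ S.card := by
  classical
  have := hT.indep.isProbabilityMeasure
  set s : {e : ℕ+ × ℕ+ // e.1 < e.2} → Set Ω := fun e => {ω | (T ω).Adj e.1.1 e.1.2} with hs
  set f : {e : ℕ+ × ℕ+ // e.1 < e.2} → Set Ω := fun e => if b e then s e else (s e)ᶜ with hf
  have hset : {ω | ∀ e ∈ S, ((T ω).Adj e.1.1 e.1.2 ↔ b e)} = ⋂ e ∈ S, f e := by
    ext ω
    simp only [Set.mem_ofPred_eq, Set.mem_iInter]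
    refine forall₂_congr fun e _ => ?_
    by_cases h : b e <;> simp [hf, hs, h]
  have hhalf : ∀ e, P (s e) = 1 / 2 := fun e => hT.prob_adj _ _ e.2.ne
  have hfe : ∀ e, P (f e) = 1 / 2 := by
    intro e
    by_cases h : b e
    · simp only [hf, h, if_true, hhalf]
    · simp only [hf, h, if_false]
      rw [prob_compl_eq_one_sub (hT.measurableSet_adj _ _), hhalf, one_div,
        ENNReal.one_sub_inv_two]
  have h := (iIndepSet_iff s P).1 hT.indep S (f := f) (fun e _ => by
    have h0 : MeasurableSet[MeasurableSpace.generateFrom {s e}] (s e) :=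
      MeasurableSpace.measurableSet_generateFrom rfl
    by_cases hb : b e
    · simpa only [hf, hb, if_true] using h0
    · simpa only [hf, hb, if_false] using h0.compl)
  rw [hset, Measure.real, h]
  simp [hfe]

/-- Each prescribed arc fixes the bit of its increasing pair; since no arc is prescribed in both
directions, these pairs are distinct. -/
theorem IsRandomTournament.prob_forall_adj (hT : IsRandomTournament P T)
    (O : Finset (ℕ+ × ℕ+)) (h1 : ∀ p ∈ O, p.1 ≠ p.2) (h2 : ∀ p ∈ O, p.swap ∉ O) :
    P.real {ω | ∀ p ∈ O, (T ω).Adj p.1 p.2} = (1 / 2) ^ O.card := by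
  classical
  let σ : ℕ+ × ℕ+ → ℕ+ × ℕ+ := fun p => if p.1 < p.2 then p else p.swap
  have hσ : ∀ p ∈ O, (σ p).1 < (σ p).2 := by
    intro p hp
    by_cases h : p.1 < p.2
    · simpa only [σ, if_pos h] using h
    · simpa only [σ, if_neg h, Prod.fst_swap, Prod.snd_swap] using lt_of_le_of_ne (not_lt.1 h) (h1 p hp).symm
  have hinj : Set.InjOn σ O := by
    intro p hp q hq hpq
    by_cases h : p.1 < p.2 <;> by_cases h' : q.1 < q.2 <;>
      simp only [σ, h, h', if_true, if_false] at hpq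
    · exact hpq
    · exact absurd (hpq ▸ hp) (h2 q hq)
    · exact absurd (hpq ▸ hq) (h2 p hp)
    · exact Prod.swap_injective hpq
  set S : Finset {e : ℕ+ × ℕ+ // e.1 < e.2} := (O.image σ).subtype _ with hS
  have hcard : S.card = O.card := by
    rw [hS, Finset.card_subtype, Finset.filter_true_of_mem, Finset.card_image_of_injOn hinj]
    intro e he
    obtain ⟨p, hp, rfl⟩ := Finset.mem_image.1 he
    exact hσ p hp
  have hset : {ω | ∀ p ∈ O, (T ω).Adj p.1 p.2} =
      {ω | ∀ e ∈ S, ((T ω).Adj e.1.1 e.1.2 ↔ e.1 ∈ O)} := by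
    ext ω
    simp only [Set.mem_ofPred_eq]
    constructor
    · rintro h ⟨e, he⟩ heS
      obtain ⟨p, hp, rfl⟩ := Finset.mem_image.1 (Finset.mem_subtype.1 heS)
      by_cases hlt : p.1 < p.2
      · simp only [σ, if_pos hlt]
        exact iff_of_true (h p hp) hp
      · simp only [σ, if_neg hlt]
        refine iff_of_false ?_ (h2 p hp)
        exact ((hT.isTournament ω).2 p.1 p.2 (h1 p hp)).1 (h p hp)
    · intro h p hp
      have hh := h ⟨σ p, hσ p hp⟩ (Finset.mem_subtype.2 (Finset.mem_image_of_mem σ hp))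
      by_cases hlt : p.1 < p.2
      · simp only [σ, if_pos hlt] at hh
        exact hh.2 hp
      · simp only [σ, if_neg hlt] at hh
        exact ((hT.isTournament ω).2 p.1 p.2 (h1 p hp)).2 fun h' => h2 p hp (hh.1 h')
  rw [hset, hT.prob_forall_adj_iff, hcard]

/-- Union bound over the set `A` of out-neighbours of `u` in `W`. Given `A`, all arcs between `u`
and `W` are determined, and `v` must dominate `A`. This has probability $2^{-|W|-|A|}$, and summing
over `A` gives $(1/2)^{|W|}(3/2)^{|W|}$. -/
theorem IsRandomTournament.prob_no_two_path_le (hT : IsRandomTournament P T) {u v : ℕ+}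
    (huv : u ≠ v) (W : Finset ℕ+) (hu : u ∉ W) (hv : v ∉ W) :
    P.real {ω | ∀ w ∈ W, ¬ ((T ω).Adj u w ∧ (T ω).Adj w v)} ≤ (3 / 4) ^ W.card := by
  classical
  have := hT.indep.isProbabilityMeasure
  -- The arcs forced by `A`: from `u` to `A`, from `W \ A` to `u`, and from `v` to `A`.
  let O : Finset ℕ+ → Finset (ℕ+ × ℕ+) := fun A =>
    A.image (fun w => (u, w)) ∪ ((W \ A).image (fun w => (w, u)) ∪ A.image (fun w => (v, w)))
  have hcard : ∀ A ∈ W.powerset, (O A).card = W.card + A.card := by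
    intro A hA
    have hAW := Finset.mem_powerset.1 hA
    rw [Finset.card_union_of_disjoint, Finset.card_union_of_disjoint,
      Finset.card_image_of_injective _ (fun a b h => (Prod.mk.inj h).2),
      Finset.card_image_of_injective _ (fun a b h => (Prod.mk.inj h).1),
      Finset.card_image_of_injective _ (fun a b h => (Prod.mk.inj h).2),
      ← add_assoc, add_comm A.card, Finset.card_sdiff_add_card_eq_card hAW]
    · rw [Finset.disjoint_left]
      intro p h1 h2
      obtain ⟨a, ha, rfl⟩ := Finset.mem_image.1 h1
      obtain ⟨b, hb, hb'⟩ := Finset.mem_image.1 h2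
      have := (Prod.mk.inj hb').1
      exact hv (this ▸ (Finset.mem_sdiff.1 ha).1)
    · rw [Finset.disjoint_left]
      intro p h1 h2
      obtain ⟨a, ha, rfl⟩ := Finset.mem_image.1 h1
      rcases Finset.mem_union.1 h2 with h2 | h2 <;> obtain ⟨b, hb, hb'⟩ := Finset.mem_image.1 h2
      · have := (Prod.mk.inj hb').1
        exact hu (this ▸ (Finset.mem_sdiff.1 hb).1)
      · exact huv (Prod.mk.inj hb').1.symm
  have hmem : ∀ A a b, (a, b) ∈ O A ↔
      (a = u ∧ b ∈ A) ∨ (b = u ∧ a ∈ W ∧ a ∉ A) ∨ (a = v ∧ b ∈ A) := by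
    intro A a b
    simp only [O, Finset.mem_union, Finset.mem_image, Finset.mem_sdiff, Prod.mk.injEq]
    constructor
    · rintro (⟨w, hw, rfl, rfl⟩ | ⟨w, hw, rfl, rfl⟩ | ⟨w, hw, rfl, rfl⟩) <;> simp_all
    · rintro (⟨rfl, hb⟩ | ⟨rfl, hb⟩ | ⟨rfl, hb⟩)
      · exact Or.inl ⟨b, hb, rfl, rfl⟩
      · exact Or.inr (Or.inl ⟨a, hb, rfl, rfl⟩)
      · exact Or.inr (Or.inr ⟨b, hb, rfl, rfl⟩)
  have hprob : ∀ A ∈ W.powerset,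
      P.real {ω | ∀ p ∈ O A, (T ω).Adj p.1 p.2} = (1 / 2) ^ (W.card + A.card) := by
    intro A hA
    have hAW := Finset.mem_powerset.1 hA
    have huA : u ∉ A := fun h => hu (hAW h)
    have hvA : v ∉ A := fun h => hv (hAW h)
    rw [hT.prob_forall_adj, hcard A hA]
    · rintro ⟨a, b⟩ hp (rfl : a = b)
      rw [hmem] at hp
      rcases hp with ⟨rfl, h⟩ | ⟨rfl, h, -⟩ | ⟨rfl, h⟩ <;> contradiction
    · rintro ⟨a, b⟩ hp hq
      rw [Prod.swap_prod_mk, hmem] at hq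
      rw [hmem] at hp
      grind
  have hsub : {ω | ∀ w ∈ W, ¬ ((T ω).Adj u w ∧ (T ω).Adj w v)} ⊆
      ⋃ A ∈ W.powerset, {ω | ∀ p ∈ O A, (T ω).Adj p.1 p.2} := by
    intro ω hω
    simp only [Set.mem_iUnion]
    refine ⟨W.filter fun w => (T ω).Adj u w, Finset.mem_powerset.2 (Finset.filter_subset _ _), ?_⟩
    rintro ⟨a, b⟩ hp
    rw [hmem] at hp
    rcases hp with ⟨rfl, h⟩ | ⟨rfl, h, h'⟩ | ⟨rfl, h⟩
    · exact (Finset.mem_filter.1 h).2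
    · have hne : a ≠ b := fun e => hu (e ▸ h)
      refine ((hT.isTournament ω).2 a b hne).2 fun k => h' (Finset.mem_filter.2 ⟨h, k⟩)
    · obtain ⟨hb, hub⟩ := Finset.mem_filter.1 h
      have hne : a ≠ b := fun e => hv (e ▸ hb)
      exact ((hT.isTournament ω).2 a b hne).2 fun k => hω b hb ⟨hub, k⟩
  calc P.real {ω | ∀ w ∈ W, ¬ ((T ω).Adj u w ∧ (T ω).Adj w v)}
      ≤ P.real (⋃ A ∈ W.powerset, {ω | ∀ p ∈ O A, (T ω).Adj p.1 p.2}) := measureReal_mono hsub (measure_ne_top _ _)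
    _ ≤ ∑ A ∈ W.powerset, P.real {ω | ∀ p ∈ O A, (T ω).Adj p.1 p.2} :=
        measureReal_biUnion_finset_le _ _
    _ = ∑ A ∈ W.powerset, (1 / 2 : ℝ) ^ W.card * ((1 / 2) ^ A.card * 1 ^ (W.card - A.card)) := by
        refine Finset.sum_congr rfl fun A hA => ?_
        rw [hprob A hA, one_pow, mul_one, pow_add]
    _ = (3 / 4) ^ W.card := by
        rw [← Finset.mul_sum, Finset.sum_pow_mul_eq_add_pow, ← mul_pow]
        norm_num

end Cylinder

/-! ### Union bound over pairs of vertices -/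

section Vertices

/-- The vertex set `{1, …, n}`, enumerated. -/
def verticesEquiv (n : ℕ) : {v : ℕ+ // (v : ℕ) ≤ n} ≃ Fin n where
  toFun v := ⟨v.1.natPred, by have := v.2; have := v.1.natPred_add_one; omega⟩
  invFun i := ⟨i.1.succPNat, i.2⟩
  left_inv v := by simp
  right_inv i := by simp

instance verticesFintype (n : ℕ) : Fintype {v : ℕ+ // (v : ℕ) ≤ n} :=
  Fintype.ofEquiv _ (verticesEquiv n).symm

theorem card_vertices (n : ℕ) : Fintype.card {v : ℕ+ // (v : ℕ) ≤ n} = n := by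
  rw [Fintype.card_congr (verticesEquiv n), Fintype.card_fin]

/-- Some pair of distinct vertices of `{1, …, n}` is not joined by a path of length two inside
`{1, …, n}`. -/
def HasFarPair (D : Digraph ℕ+) (n : ℕ) : Prop :=
  ∃ u v : {v : ℕ+ // (v : ℕ) ≤ n}, u ≠ v ∧ ∀ w : {v : ℕ+ // (v : ℕ) ≤ n}, w ≠ u → w ≠ v →
    ¬ (D.Adj u w ∧ D.Adj w v)

variable {Ω : Type*} [MeasurableSpace Ω] {P : Measure Ω} {T : Ω → Digraph ℕ+}

theorem IsRandomTournament.prob_hasFarPair_le (hT : IsRandomTournament P T) (n : ℕ) :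
    P.real {ω | HasFarPair (T ω) n} ≤ n ^ 2 * (3 / 4) ^ (n - 2) := by
  classical
  have := hT.indep.isProbabilityMeasure
  set V := {v : ℕ+ // (v : ℕ) ≤ n} with hV
  let B : V × V → Set Ω := fun p => {ω | p.1 ≠ p.2 ∧ ∀ w : V, w ≠ p.1 → w ≠ p.2 →
    ¬ ((T ω).Adj p.1 w ∧ (T ω).Adj w p.2)}
  have hsub : {ω | HasFarPair (T ω) n} ⊆ ⋃ p ∈ (Finset.univ : Finset (V × V)), B p := by
    rintro ω ⟨u, v, h⟩
    simp only [Set.mem_iUnion]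
    exact ⟨(u, v), Finset.mem_univ _, h⟩
  have hB : ∀ p, P.real (B p) ≤ (3 / 4) ^ (n - 2) := by
    rintro ⟨u, v⟩
    by_cases huv : u = v
    · have : B (u, v) = ∅ := by
        ext ω
        simp [B, huv]
      rw [this]
      simp only [measureReal_empty]
      positivity
    · set W : Finset ℕ+ := ((Finset.univ.erase u).erase v).map (Function.Embedding.subtype _)
      have hc : W.card = n - 2 := by
        rw [Finset.card_map, Finset.card_erase_of_mem (by simp [Ne.symm huv]),
          Finset.card_erase_of_mem (Finset.mem_univ _), Finset.card_univ, card_vertices]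
        omega
      rw [← hc]
      refine le_trans (measureReal_mono ?_) (hT.prob_no_two_path_le (u := u) (v := v)
        (fun e => huv (Subtype.ext e)) W (by simp [W]) (by simp [W]))
      rintro ω ⟨-, h⟩ w hw
      obtain ⟨w, hwm, rfl⟩ := Finset.mem_map.1 hw
      obtain ⟨hwv, hwu⟩ := Finset.mem_erase.1 hwm
      exact h w (Finset.mem_erase.1 hwu).1 hwv
  calc P.real {ω | HasFarPair (T ω) n}
      ≤ P.real (⋃ p ∈ (Finset.univ : Finset (V × V)), B p) := measureReal_mono hsub (measure_ne_top _ _)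
    _ ≤ ∑ p : V × V, P.real (B p) := measureReal_biUnion_finset_le _ _
    _ ≤ ∑ _p : V × V, (3 / 4 : ℝ) ^ (n - 2) := Finset.sum_le_sum fun p _ => hB p
    _ = n ^ 2 * (3 / 4) ^ (n - 2) := by
      rw [Finset.sum_const, Finset.card_univ, Fintype.card_prod, card_vertices, nsmul_eq_mul]
      push_cast
      ring

end Vertices

/-! ### Hoeffding's lemma for uniform bits -/

section Uniform

variable {V : Type*} [Fintype V] [DecidableEq V]

/-- The mean of `g` under uniform independent bits. -/
noncomputable def rowMean (g : (V → Bool) → ℝ) : ℝ :=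
  (∑ r, g r) / 2 ^ Fintype.card V

theorem rowMean_const (c : ℝ) : rowMean (fun _ : V → Bool => c) = c := by
  simp [rowMean]

theorem rowMean_sub (g h : (V → Bool) → ℝ) :
    rowMean (fun r => g r - h r) = rowMean g - rowMean h := by
  simp [rowMean, Finset.sum_sub_distrib, sub_div]

theorem rowMean_mono {g h : (V → Bool) → ℝ} (hgh : ∀ r, g r ≤ h r) : rowMean g ≤ rowMean h := by
  unfold rowMean
  gcongr with r
  exact hgh r

theorem rowMean_mul_const (g : (V → Bool) → ℝ) (c : ℝ) :
    rowMean (fun r => g r * c) = rowMean g * c := by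
  rw [rowMean, rowMean, ← Finset.sum_mul, div_mul_eq_mul_div]

theorem rowMean_add (g h : (V → Bool) → ℝ) :
    rowMean (fun r => g r + h r) = rowMean g + rowMean h := by
  simp [rowMean, Finset.sum_add_distrib, add_div]

/-- Convexity: the exponential lies below its chord between `-t` and `t`. -/
theorem exp_mul_le_of_abs_le_one (t : ℝ) {z : ℝ} (hz : |z| ≤ 1) :
    Real.exp (t * z) ≤ Real.cosh t + z * Real.sinh t := by
  obtain ⟨h1, h2⟩ := abs_le.1 hz
  have h := convexOn_exp.2 (Set.mem_univ t) (Set.mem_univ (-t))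
    (show 0 ≤ (1 + z) / 2 by linarith) (show 0 ≤ (1 - z) / 2 by linarith) (by ring)
  simp only [smul_eq_mul] at h
  rw [Real.cosh_eq, Real.sinh_eq]
  calc Real.exp (t * z) = Real.exp ((1 + z) / 2 * t + (1 - z) / 2 * -t) := by congr 1; ring
    _ ≤ _ := h
    _ = _ := by ring

theorem rowMean_exp_le (t : ℝ) {z : (V → Bool) → ℝ} (hz : ∀ r, |z r| ≤ 1) (h0 : rowMean z = 0) :
    rowMean (fun r => Real.exp (t * z r)) ≤ Real.exp (t ^ 2 / 2) :=
  calc rowMean (fun r => Real.exp (t * z r))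
      ≤ rowMean (fun r => Real.cosh t + z r * Real.sinh t) :=
        rowMean_mono fun r => exp_mul_le_of_abs_le_one t (hz r)
    _ = Real.cosh t := by rw [rowMean_add, rowMean_const, rowMean_mul_const, h0]; ring
    _ ≤ Real.exp (t ^ 2 / 2) := Real.cosh_le_exp_half_sq t

end Uniform

/-! ### From the random tournament to uniform bits -/

section Transport

variable {n : ℕ}

/-- The adjacency matrix of the digraph induced on `{1, …, n}`. -/
noncomputable def adjMatrix (D : Digraph ℕ+) (n : ℕ) (u v : {v : ℕ+ // (v : ℕ) ≤ n}) : Bool :=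
  open Classical in decide (D.Adj u v)

/-- The tournament on a linearly ordered set with prescribed orientations. -/
def orient {V : Type*} [LinearOrder V] (x : {e : V × V // e.1 < e.2} → Bool) (u v : V) : Bool :=
  if h : u < v then x ⟨(u, v), h⟩ else if h : v < u then !x ⟨(v, u), h⟩ else false

/-- The orientations of the pairs in `{1, …, n}`. -/
noncomputable def pairBits (D : Digraph ℕ+) (n : ℕ)
    (e : {e : {v : ℕ+ // (v : ℕ) ≤ n} × {v : ℕ+ // (v : ℕ) ≤ n} // e.1 < e.2}) : Bool :=
  adjMatrix D n e.1.1 e.1.2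

theorem orient_pairBits {D : Digraph ℕ+} (hD : IsTournament D) :
    orient (pairBits D n) = adjMatrix D n := by
  funext u v
  rcases lt_trichotomy u v with h | rfl | h
  · simp [orient, pairBits, h]
  · simp [orient, adjMatrix, hD.1]
  · have := hD.2 u v (fun e => h.ne (Subtype.ext e.symm))
    by_cases hvu : D.Adj v u <;> simp [orient, pairBits, h, h.not_gt, adjMatrix, this, hvu]

/-- Bits on non-increasing pairs are averaged out. Adding these dummy bits makes room for the
independent rows used in decoupling. -/
theorem sum_orient_restrict {V : Type*} [Fintype V] [LinearOrder V] (F : (V → V → Bool) → ℝ) :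
    (∑ y : V × V → Bool, F (orient fun e => y e.1)) / 2 ^ Fintype.card (V × V) =
      (∑ x : {e : V × V // e.1 < e.2} → Bool, F (orient x)) /
        2 ^ Fintype.card {e : V × V // e.1 < e.2} := by
  have h := Fintype.sum_equiv
    (Equiv.piEquivPiSubtypeProd (fun e : V × V => e.1 < e.2) fun _ => Bool)
    (fun y => F (orient fun e => y e.1)) (fun p => F (orient p.1)) fun y => rfl
  have hcard : (2 : ℝ) ^ Fintype.card (V × V) = 2 ^ Fintype.card {e : V × V // e.1 < e.2} *
      2 ^ Fintype.card {e : V × V // ¬ e.1 < e.2} := by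
    rw [← pow_add, ← Fintype.card_sum, Fintype.card_congr (Equiv.sumCompl fun e : V × V => e.1 < e.2)]
  rw [h, Fintype.sum_prod_type]
  simp only [Finset.sum_const, Finset.card_univ, Fintype.card_pi, Fintype.card_bool,
    Finset.prod_const, nsmul_eq_mul, ← Finset.mul_sum]
  rw [hcard]
  push_cast
  field_simp

variable {Ω : Type*} [MeasurableSpace Ω] {P : Measure Ω} {T : Ω → Digraph ℕ+}

theorem IsRandomTournament.measurable_adjMatrix (hT : IsRandomTournament P T) :
    Measurable fun ω => adjMatrix (T ω) n := by
  refine measurable_pi_lambda _ fun u => measurable_pi_lambda _ fun v => ?_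
  classical
  refine measurable_to_bool ?_
  convert hT.measurableSet_adj u v using 1
  ext ω
  simp [adjMatrix]

theorem IsRandomTournament.measurable_pairBits (hT : IsRandomTournament P T) :
    Measurable fun ω => pairBits (T ω) n :=
  measurable_pi_lambda _ fun e =>
    (measurable_pi_apply e.1.2).comp ((measurable_pi_apply e.1.1).comp hT.measurable_adjMatrix)

theorem IsRandomTournament.integrable_comp_adjMatrix [IsProbabilityMeasure P]
    (hT : IsRandomTournament P T)
    (F : ({v : ℕ+ // (v : ℕ) ≤ n} → {v : ℕ+ // (v : ℕ) ≤ n} → Bool) → ℝ) :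
    Integrable (fun ω => F (adjMatrix (T ω) n)) P :=
  (Integrable.of_finite (μ := P.map fun ω => adjMatrix (T ω) n)).comp_measurable
    hT.measurable_adjMatrix

theorem IsRandomTournament.prob_pairBits_eq (hT : IsRandomTournament P T)
    (x : {e : {v : ℕ+ // (v : ℕ) ≤ n} × {v : ℕ+ // (v : ℕ) ≤ n} // e.1 < e.2} → Bool) :
    P.real {ω | pairBits (T ω) n = x} = (1 / 2) ^ Fintype.card
      {e : {v : ℕ+ // (v : ℕ) ≤ n} × {v : ℕ+ // (v : ℕ) ≤ n} // e.1 < e.2} := by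
  let ι : {e : {v : ℕ+ // (v : ℕ) ≤ n} × {v : ℕ+ // (v : ℕ) ≤ n} // e.1 < e.2} ↪
      {e : ℕ+ × ℕ+ // e.1 < e.2} :=
    ⟨fun e => ⟨(e.1.1.1, e.1.2.1), e.2⟩, fun e e' h => by
      have h := Prod.mk.inj (congrArg Subtype.val h)
      exact Subtype.ext (Prod.ext (Subtype.ext h.1) (Subtype.ext h.2))⟩
  have h := hT.prob_forall_adj_iff (Finset.univ.map ι) fun e => ∃ e', ι e' = e ∧ x e' = true
  rw [Finset.card_map, Finset.card_univ] at h
  rw [← h]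
  congr 1
  ext ω
  simp only [Set.mem_ofPred_eq, Finset.forall_mem_map, Finset.mem_univ, forall_true_left,
    ι.injective.eq_iff, exists_eq_left, funext_iff]
  refine forall_congr' fun e => ?_
  rw [Bool.eq_iff_iff]
  simp only [pairBits, adjMatrix, decide_eq_true_eq]
  rfl

theorem IsRandomTournament.integral_comp_adjMatrix [IsProbabilityMeasure P]
    (hT : IsRandomTournament P T)
    (F : ({v : ℕ+ // (v : ℕ) ≤ n} → {v : ℕ+ // (v : ℕ) ≤ n} → Bool) → ℝ) :
    ∫ ω, F (adjMatrix (T ω) n) ∂P =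
      (∑ y : {v : ℕ+ // (v : ℕ) ≤ n} × {v : ℕ+ // (v : ℕ) ≤ n} → Bool,
        F (orient fun e => y e.1)) /
        2 ^ Fintype.card ({v : ℕ+ // (v : ℕ) ≤ n} × {v : ℕ+ // (v : ℕ) ≤ n}) := by
  have hm := hT.measurable_pairBits (n := n)
  have hprob := Measure.isProbabilityMeasure_map (μ := P) hm.aemeasurable
  have hint : ∫ ω, F (adjMatrix (T ω) n) ∂P =
      ∫ x, F (orient x) ∂(P.map fun ω => pairBits (T ω) n) := by
    rw [integral_map hm.aemeasurable Integrable.of_finite.aestronglyMeasurable]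
    simp only [orient_pairBits (hT.isTournament _)]
  rw [hint, integral_fintype Integrable.of_finite]
  refine Eq.trans ?_ (Eq.trans (sum_orient_restrict F).symm ?_)
  swap
  · congr!
  rw [Finset.sum_div]
  refine Finset.sum_congr rfl fun x _ => ?_
  rw [map_measureReal_apply hm (measurableSet_singleton x)]
  have := hT.prob_pairBits_eq x
  rw [show (fun ω => pairBits (T ω) n) ⁻¹' {x} = {ω | pairBits (T ω) n = x} from rfl, this,
    smul_eq_mul, one_div, inv_pow, inv_mul_eq_div]

/-- The rows of the adjacency matrix of a random tournament are negatively dependent. -/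
theorem IsRandomTournament.integral_prod_adjMatrix_le [IsProbabilityMeasure P]
    (hT : IsRandomTournament P T)
    {f : {v : ℕ+ // (v : ℕ) ≤ n} → ({v : ℕ+ // (v : ℕ) ≤ n} → Bool) → ℝ}
    (hf0 : ∀ u r, 0 ≤ f u r) (hf : (∀ u, Monotone (f u)) ∨ ∀ u, Antitone (f u))
    (hdiag : ∀ u r, f u (Function.update r u false) = f u r) :
    ∫ ω, ∏ u, f u (adjMatrix (T ω) n u) ∂P ≤ ∏ u, rowMean (f u) := by
  rw [hT.integral_comp_adjMatrix fun a => ∏ u, f u (a u)]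
  simp only [rowMean]
  rw [Finset.prod_div_distrib, Finset.prod_const, Finset.card_univ, ← pow_mul, Fintype.card_prod]
  have h := sum_prod_glue_le hf0 hf
    (Finset.univ.filter fun p : {v : ℕ+ // (v : ℕ) ≤ n} × {v : ℕ+ // (v : ℕ) ≤ n} => p.1 < p.2)
    (by simp)
  have key : ∀ (y : {v : ℕ+ // (v : ℕ) ≤ n} × {v : ℕ+ // (v : ℕ) ≤ n} → Bool) u,
      f u (orient (fun e => y e.1) u) =
      f u (glue (Finset.univ.filter fun p => p.1 < p.2) y u) := by
    intro y u
    -- The two matrices differ only on the diagonal, where `orient` has `false` and `glue` keeps the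
    -- bit `y (u, u)`; `hdiag` makes this entry irrelevant.
    rw [← hdiag u (glue _ y u)]
    congr 1
    funext v
    rcases lt_trichotomy u v with h | rfl | h
    · simp [orient, glue, h, h.ne', h.not_gt]
    · simp [orient]
    · simp [orient, glue, h, h.ne, h.not_gt]
  simp only [key]
  refine div_le_div_of_nonneg_right ?_ (by positivity)
  refine (le_of_eq ?_).trans (h.trans_eq ?_) <;> congr!

theorem IsRandomTournament.integral_row_le [IsProbabilityMeasure P]
    (hT : IsRandomTournament P T) (u : {v : ℕ+ // (v : ℕ) ≤ n})
    {g : ({v : ℕ+ // (v : ℕ) ≤ n} → Bool) → ℝ} (hg0 : ∀ r, 0 ≤ g r)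
    (hg : Monotone g ∨ Antitone g) (hdiag : ∀ r, g (Function.update r u false) = g r) :
    ∫ ω, g (adjMatrix (T ω) n u) ∂P ≤ rowMean g := by
  have h := hT.integral_prod_adjMatrix_le (f := fun w r => if w = u then g r else 1) (n := n) ?_ ?_ ?_
  · have h1 : ∀ w, rowMean (fun r => if w = u then g r else 1) = if w = u then rowMean g else 1 := by
      intro w
      by_cases hw : w = u <;> simp [hw, rowMean_const]
    simp only [h1, Finset.prod_ite_eq', Finset.mem_univ, if_true] at h
    exact h
  · intro w r
    by_cases hw : w = u <;> simp [hw, hg0 r]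
  · refine hg.imp (fun hg w => ?_) (fun hg w => ?_) <;> by_cases hw : w = u <;>
      simp only [hw, if_true, if_false]
    exacts [hg, monotone_const, hg, antitone_const]
  · intro w r
    by_cases hw : w = u
    · subst hw
      simp [hdiag]
    · simp [hw]

/-- The one-row inequality applies both to the antitone `g` and to the monotone `1 - g`, which
forces equality. -/
theorem IsRandomTournament.integral_row [IsProbabilityMeasure P]
    (hT : IsRandomTournament P T) (u : {v : ℕ+ // (v : ℕ) ≤ n})
    {g : ({v : ℕ+ // (v : ℕ) ≤ n} → Bool) → ℝ} (hg0 : ∀ r, 0 ≤ g r) (hg1 : ∀ r, g r ≤ 1)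
    (hg : Antitone g) (hdiag : ∀ r, g (Function.update r u false) = g r) :
    ∫ ω, g (adjMatrix (T ω) n u) ∂P = rowMean g := by
  refine le_antisymm (hT.integral_row_le u hg0 (Or.inr hg) hdiag) ?_
  have h := hT.integral_row_le u (g := fun r => 1 - g r) (fun r => sub_nonneg.2 (hg1 r))
    (Or.inl fun r s hrs => sub_le_sub_left (hg hrs) 1) (fun r => by rw [hdiag])
  rw [integral_sub (integrable_const _) (hT.integrable_comp_adjMatrix fun a => g (a u)),
    rowMean_sub, rowMean_const] at h
  simp only [integral_const, probReal_univ, smul_eq_mul, mul_one] at h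
  linarith

end Transport

/-! ### Sub-Gaussian concentration of the low-degree count -/

section Concentration

variable {n : ℕ}

/-- The indicator that the row `r` of `u` has at most `(|V| - 1) / 2` off-diagonal entries. -/
def lowDegree {V : Type*} [Fintype V] [DecidableEq V] (u : V) (r : V → Bool) : ℝ :=
  if 2 * (Finset.univ.filter fun v : V => v ≠ u ∧ r v = true).card + 1 ≤ Fintype.card V then 1 else 0

theorem lowDegree_nonneg {V : Type*} [Fintype V] [DecidableEq V] (u : V) (r : V → Bool) :
    0 ≤ lowDegree u r := by
  unfold lowDegree; split_ifs <;> norm_num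

theorem lowDegree_le_one {V : Type*} [Fintype V] [DecidableEq V] (u : V) (r : V → Bool) :
    lowDegree u r ≤ 1 := by
  unfold lowDegree; split_ifs <;> norm_num

theorem lowDegree_antitone {V : Type*} [Fintype V] [DecidableEq V] (u : V) :
    Antitone (lowDegree u) := by
  intro r s hrs
  have hle : (Finset.univ.filter fun v : V => v ≠ u ∧ r v = true).card ≤
      (Finset.univ.filter fun v : V => v ≠ u ∧ s v = true).card := by
    refine Finset.card_le_card fun v hv => ?_
    simp only [Finset.mem_filter, Finset.mem_univ, true_and] at hv ⊢
    exact ⟨hv.1, hrs v hv.2⟩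
  unfold lowDegree
  split_ifs
  · rfl
  · omega
  · norm_num
  · rfl

theorem lowDegree_update {V : Type*} [Fintype V] [DecidableEq V] (u : V) (r : V → Bool) :
    lowDegree u (Function.update r u false) = lowDegree u r := by
  have h : (Finset.univ.filter fun v : V => v ≠ u ∧ Function.update r u false v = true) =
      Finset.univ.filter fun v : V => v ≠ u ∧ r v = true :=
    Finset.filter_congr fun v _ => and_congr_right fun hv => by rw [Function.update_of_ne hv]
  unfold lowDegree
  rw [h]

/-- The number of vertices of `{1, …, n}` dominating at most half of the other vertices. -/
noncomputable def lowDegreeCount (D : Digraph ℕ+) (n : ℕ) : ℝ :=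
  ∑ u, lowDegree u (adjMatrix D n u)

variable {Ω : Type*} [MeasurableSpace Ω] {P : Measure Ω} {T : Ω → Digraph ℕ+}

/-- Negative dependence bounds the moment generating function by a product over the `n` rows. Each
centred indicator lies in $[-1,1]$ and contributes at most $e^{t^2/2}$. -/
theorem IsRandomTournament.hasSubgaussianMGF_lowDegreeCount [IsProbabilityMeasure P]
    (hT : IsRandomTournament P T) (n : ℕ) :
    HasSubgaussianMGF
      (fun ω => lowDegreeCount (T ω) n - ∫ ω', lowDegreeCount (T ω') n ∂P) n P := by
  set p : {v : ℕ+ // (v : ℕ) ≤ n} → ℝ := fun u => rowMean (lowDegree u) with hp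
  have hmean : ∫ ω', lowDegreeCount (T ω') n ∂P = ∑ u, p u := by
    unfold lowDegreeCount
    rw [integral_finsetSum _ fun u _ => hT.integrable_comp_adjMatrix fun a => lowDegree u (a u)]
    exact Finset.sum_congr rfl fun u _ => hT.integral_row u (lowDegree_nonneg u)
      (lowDegree_le_one u) (lowDegree_antitone u) (lowDegree_update u)
  have hp0 : ∀ u, 0 ≤ p u := fun u => by
    simpa only [rowMean_const] using rowMean_mono (lowDegree_nonneg u)
  have hp1 : ∀ u, p u ≤ 1 := fun u => by
    simpa only [rowMean_const] using rowMean_mono (lowDegree_le_one u)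
  have hexp : ∀ t ω, Real.exp (t * (lowDegreeCount (T ω) n - ∫ ω', lowDegreeCount (T ω') n ∂P)) =
      ∏ u, Real.exp (t * (lowDegree u (adjMatrix (T ω) n u) - p u)) := by
    intro t ω
    rw [hmean, lowDegreeCount, ← Finset.sum_sub_distrib, Finset.mul_sum, Real.exp_sum]
  refine ⟨fun t => ?_, fun t => ?_⟩
  · simp only [hexp]
    exact hT.integrable_comp_adjMatrix fun a => ∏ u, Real.exp (t * (lowDegree u (a u) - p u))
  · rw [mgf]
    simp only [hexp]
    calc ∫ ω, ∏ u, Real.exp (t * (lowDegree u (adjMatrix (T ω) n u) - p u)) ∂P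
        ≤ ∏ u, rowMean (fun r => Real.exp (t * (lowDegree u r - p u))) := by
          refine hT.integral_prod_adjMatrix_le
            (f := fun u r => Real.exp (t * (lowDegree u r - p u))) (fun u r => Real.exp_nonneg _)
            ?_ fun u r => by rw [lowDegree_update]
          -- The sign of `t` decides whether all factors are antitone or all are monotone;
          -- decoupling allows either.
          rcases le_total 0 t with ht | ht
          · right
            intro u r s hrs
            have := lowDegree_antitone u hrs
            exact Real.exp_le_exp.2 (mul_le_mul_of_nonneg_left (by linarith) ht)
          · left
            intro u r s hrs
            have := lowDegree_antitone u hrs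
            exact Real.exp_le_exp.2 (mul_le_mul_of_nonpos_left (by linarith) ht)
      _ ≤ ∏ _u : {v : ℕ+ // (v : ℕ) ≤ n}, Real.exp (t ^ 2 / 2) := by
          refine Finset.prod_le_prod (fun u _ => ?_) fun u _ => ?_
          · simpa only [rowMean_const] using rowMean_mono
              (g := fun _ => (0 : ℝ)) fun r => Real.exp_nonneg (t * (lowDegree u r - p u))
          · refine rowMean_exp_le t (fun r => ?_) ?_
            · have := lowDegree_nonneg u r
              have := lowDegree_le_one u r
              have := hp0 u
              have := hp1 u
              rw [abs_le]
              constructor <;> linarith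
            · rw [rowMean_sub, rowMean_const, sub_self]
      _ = Real.exp ((n : NNReal) * t ^ 2 / 2) := by
          rw [Finset.prod_const, Finset.card_univ, card_vertices, ← Real.exp_nat_mul]
          congr 1
          push_cast
          ring

theorem IsRandomTournament.prob_abs_lowDegreeCount_sub_ge [IsProbabilityMeasure P]
    (hT : IsRandomTournament P T) (n : ℕ) {a : ℝ} (ha : 0 ≤ a) :
    P.real {ω | a ≤ |lowDegreeCount (T ω) n - ∫ ω', lowDegreeCount (T ω') n ∂P|} ≤
      2 * Real.exp (-a ^ 2 / (2 * n)) := by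
  have h := hT.hasSubgaussianMGF_lowDegreeCount n
  have h1 := h.measure_ge_le ha
  have h2 := h.neg.measure_ge_le ha
  calc P.real {ω | a ≤ |lowDegreeCount (T ω) n - ∫ ω', lowDegreeCount (T ω') n ∂P|}
      ≤ P.real ({ω | a ≤ lowDegreeCount (T ω) n - ∫ ω', lowDegreeCount (T ω') n ∂P} ∪
        {ω | a ≤ -(lowDegreeCount (T ω) n - ∫ ω', lowDegreeCount (T ω') n ∂P)}) :=
        measureReal_mono fun ω (hω : a ≤ |_|) => le_abs.1 hω
    _ ≤ _ := measureReal_union_le _ _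
    _ ≤ 2 * Real.exp (-a ^ 2 / (2 * n)) := by
      rw [two_mul]
      exact add_le_add (by simpa using h1) (by simpa using h2)

end Concentration

/-! ### Comparing Seymour vertices with low-degree vertices -/

section Comparison

variable {n : ℕ}

theorem lowDegree_adjMatrix {D : Digraph ℕ+} (hD : IsTournament D)
    (u : {v : ℕ+ // (v : ℕ) ≤ n}) [Decidable (2 * {v | (firstVertices D n).Adj u v}.ncard + 1 ≤ n)] :
    lowDegree u (adjMatrix D n u) =
      if 2 * {v | (firstVertices D n).Adj u v}.ncard + 1 ≤ n then 1 else 0 := by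
  have h : {v | (firstVertices D n).Adj u v} =
      (Finset.univ.filter fun v => v ≠ u ∧ adjMatrix D n u v = true : Finset _) := by
    ext v
    rw [Finset.mem_coe, Finset.mem_filter]
    simp only [firstVertices, Set.mem_ofPred_eq, adjMatrix, Finset.mem_univ, true_and,
      decide_eq_true_eq]
    exact ⟨fun h => ⟨fun e => hD.1 u (e ▸ h), h⟩, fun h => h.2⟩
  have hc := congrArg Set.ncard h
  rw [Set.ncard_coe_finset] at hc
  unfold lowDegree
  rw [card_vertices]
  simp only [hc]

theorem seymourCount_eq_of_not_hasFarPair {D : Digraph ℕ+} (hD : IsTournament D)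
    (hfar : ¬ HasFarPair D n) : (seymourCount D n : ℝ) = lowDegreeCount D n := by
  classical
  have hirr : ∀ v, ¬ (firstVertices D n).Adj v v := fun v => hD.1 v
  have hdiam : ∀ u v, u ≠ v → (firstVertices D n).Adj u v ∨
      ∃ w, (firstVertices D n).Adj u w ∧ (firstVertices D n).Adj w v := by
    intro u v huv
    by_contra hcon
    refine hfar ⟨u, v, huv, fun w _ _ h => hcon (Or.inr ⟨w, h⟩)⟩
  have hset : {v | IsSeymour (firstVertices D n) v} = (Finset.univ.filter fun u =>
      2 * {v | (firstVertices D n).Adj u v}.ncard + 1 ≤ n : Finset _) := by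
    ext u
    simp only [Set.mem_ofPred_eq, Finset.coe_filter, Finset.mem_univ, true_and]
    rw [isSeymour_iff_of_diam_le_two hirr hdiam, Nat.card_eq_fintype_card, card_vertices]
  rw [seymourCount, hset, Set.ncard_coe_finset, lowDegreeCount]
  simp only [lowDegree_adjMatrix hD]
  rw [Finset.sum_boole]

theorem seymourCount_le (D : Digraph ℕ+) (n : ℕ) : seymourCount D n ≤ n := by
  have h := Set.ncard_le_card {v | IsSeymour (firstVertices D n) v}
  rwa [Nat.card_eq_fintype_card, card_vertices] at h

theorem lowDegreeCount_nonneg (D : Digraph ℕ+) (n : ℕ) : 0 ≤ lowDegreeCount D n :=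
  Finset.sum_nonneg fun u _ => lowDegree_nonneg u _

theorem lowDegreeCount_le (D : Digraph ℕ+) (n : ℕ) : lowDegreeCount D n ≤ n :=
  calc lowDegreeCount D n ≤ ∑ _u : {v : ℕ+ // (v : ℕ) ≤ n}, (1 : ℝ) :=
        Finset.sum_le_sum fun u _ => lowDegree_le_one u _
    _ = n := by simp [card_vertices]

theorem abs_seymourCount_sub_lowDegreeCount_le (D : Digraph ℕ+) (n : ℕ) :
    |(seymourCount D n : ℝ) - lowDegreeCount D n| ≤ n := by
  have h1 : (seymourCount D n : ℝ) ≤ n := by exact_mod_cast seymourCount_le D n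
  have h2 : (0 : ℝ) ≤ seymourCount D n := Nat.cast_nonneg _
  have h3 := lowDegreeCount_nonneg D n
  have h4 := lowDegreeCount_le D n
  rw [abs_le]
  constructor <;> linarith

/-- The digraph with a given adjacency matrix. -/
def ofMatrix {V : Type*} (a : V → V → Bool) : Digraph V where
  Adj u v := a u v = true

theorem ofMatrix_adjMatrix (D : Digraph ℕ+) (n : ℕ) :
    ofMatrix (adjMatrix D n) = firstVertices D n := by
  unfold ofMatrix firstVertices
  congr 1
  funext u v
  simp [adjMatrix]

variable {Ω : Type*} [MeasurableSpace Ω] {P : Measure Ω} {T : Ω → Digraph ℕ+}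

/-- The count depends only on the adjacency matrix, which takes finitely many values. -/
theorem IsRandomTournament.integrable_seymourCount [IsProbabilityMeasure P]
    (hT : IsRandomTournament P T) (n : ℕ) :
    Integrable (fun ω => (seymourCount (T ω) n : ℝ)) P := by
  have h := hT.integrable_comp_adjMatrix (n := n) fun a =>
    ({v | IsSeymour (ofMatrix a) v}.ncard : ℝ)
  simp only [ofMatrix_adjMatrix] at h
  exact h

theorem IsRandomTournament.integrable_lowDegreeCount [IsProbabilityMeasure P]
    (hT : IsRandomTournament P T) (n : ℕ) :
    Integrable (fun ω => lowDegreeCount (T ω) n) P :=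
  hT.integrable_comp_adjMatrix (n := n) fun a => ∑ u, lowDegree u (a u)

theorem IsRandomTournament.measurableSet_hasFarPair (hT : IsRandomTournament P T) (n : ℕ) :
    MeasurableSet {ω | HasFarPair (T ω) n} := by
  have h : {ω | HasFarPair (T ω) n} = (fun ω => adjMatrix (T ω) n) ⁻¹'
      {a | ∃ u v, u ≠ v ∧ ∀ w, w ≠ u → w ≠ v → ¬ (a u w = true ∧ a w v = true)} := by
    ext ω
    simp only [HasFarPair, adjMatrix, Set.mem_ofPred_eq, Set.mem_preimage, decide_eq_true_eq]
  rw [h]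
  exact hT.measurable_adjMatrix (Set.toFinite _).measurableSet

/-- The two counts agree unless there is a far pair, and never differ by more than `n`. -/
theorem IsRandomTournament.abs_integral_sub_le [IsProbabilityMeasure P]
    (hT : IsRandomTournament P T) (n : ℕ) :
    |∫ ω, (seymourCount (T ω) n : ℝ) ∂P - ∫ ω, lowDegreeCount (T ω) n ∂P| ≤
      n * P.real {ω | HasFarPair (T ω) n} := by
  rw [← integral_sub (hT.integrable_seymourCount n) (hT.integrable_lowDegreeCount n)]
  calc |∫ ω, ((seymourCount (T ω) n : ℝ) - lowDegreeCount (T ω) n) ∂P|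
      ≤ ∫ ω, |(seymourCount (T ω) n : ℝ) - lowDegreeCount (T ω) n| ∂P := abs_integral_le_integral_abs
    _ ≤ ∫ ω, {ω | HasFarPair (T ω) n}.indicator (fun _ => (n : ℝ)) ω ∂P := by
        refine integral_mono
          ((hT.integrable_seymourCount n).sub (hT.integrable_lowDegreeCount n)).abs
          ((integrable_const _).indicator (hT.measurableSet_hasFarPair n)) fun ω => ?_
        by_cases h : HasFarPair (T ω) n
        · rw [Set.indicator_of_mem (show ω ∈ {ω | HasFarPair (T ω) n} from h)]
          exact abs_seymourCount_sub_lowDegreeCount_le _ n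
        · rw [Set.indicator_of_notMem (show ω ∉ {ω | HasFarPair (T ω) n} from h)]
          dsimp only
          rw [seymourCount_eq_of_not_hasFarPair (hT.isTournament ω) h, sub_self, abs_zero]
    _ = n * P.real {ω | HasFarPair (T ω) n} := by
        rw [integral_indicator_const _ (hT.measurableSet_hasFarPair n), smul_eq_mul, mul_comm]

/-- Of the deviation `2 * a`, one `a` absorbs the difference of the means and the other is left for
the fluctuation of the low-degree count. -/
theorem IsRandomTournament.prob_abs_seymourCount_sub_gt_le [IsProbabilityMeasure P]
    (hT : IsRandomTournament P T) (n : ℕ) {a : ℝ} (ha : 0 ≤ a)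
    (hn : n * P.real {ω | HasFarPair (T ω) n} ≤ a) :
    P.real {ω | |(seymourCount (T ω) n : ℝ) - ∫ ω', (seymourCount (T ω') n : ℝ) ∂P| > 2 * a} ≤
      P.real {ω | HasFarPair (T ω) n} + 2 * Real.exp (-a ^ 2 / (2 * n)) := by
  have hE := (hT.abs_integral_sub_le n).trans hn
  refine le_trans ?_ (add_le_add le_rfl (hT.prob_abs_lowDegreeCount_sub_ge n ha))
  refine le_trans (measureReal_mono ?_) (measureReal_union_le _ _)
  intro ω hω
  by_cases h : HasFarPair (T ω) n
  · exact Or.inl h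
  · right
    have hω' : 2 * a < |(seymourCount (T ω) n : ℝ) - ∫ ω', (seymourCount (T ω') n : ℝ) ∂P| := hω
    rw [seymourCount_eq_of_not_hasFarPair (hT.isTournament ω) h] at hω'
    rw [abs_sub_comm] at hE
    have := abs_sub_le (lowDegreeCount (T ω) n) (∫ ω', lowDegreeCount (T ω') n ∂P)
      (∫ ω', (seymourCount (T ω') n : ℝ) ∂P)
    show a ≤ |_|
    linarith

end Comparison

/-! ### Summability of the error bounds -/

section Asymptotics

theorem three_quarters_pow_sub_two_le (n : ℕ) : (3 / 4 : ℝ) ^ (n - 2) ≤ 16 / 9 * (3 / 4) ^ n := by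
  match n with
  | 0 => norm_num
  | 1 => norm_num
  | n + 2 =>
    rw [Nat.add_sub_cancel, pow_add]
    refine le_of_eq ?_
    ring

theorem summable_far_bound (k : ℕ) :
    Summable fun n : ℕ => (n : ℝ) ^ k * (3 / 4 : ℝ) ^ (n - 2) := by
  have h := (summable_pow_mul_geometric_of_norm_lt_one k
    (r := (3 / 4 : ℝ)) (by norm_num [abs_of_pos])).mul_left (16 / 9)
  refine Summable.of_nonneg_of_le (fun n => by positivity) (fun n => ?_) h
  calc (n : ℝ) ^ k * (3 / 4 : ℝ) ^ (n - 2) ≤ n ^ k * (16 / 9 * (3 / 4) ^ n) := by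
        gcongr
        exact three_quarters_pow_sub_two_le n
    _ = _ := by ring

theorem summable_exp_neg_rpow {c δ : ℝ} (hc : 0 < c) (hδ : 0 < δ) :
    Summable fun n : ℕ => Real.exp (-c * (n : ℝ) ^ δ) := by
  -- The exponent `-2 / δ`, evaluated at $n^\delta$, gives comparison with the summable $n^{-2}$.
  have h := (isLittleO_exp_neg_mul_rpow_atTop hc (-2 / δ)).comp_tendsto
    ((tendsto_rpow_atTop hδ).comp tendsto_natCast_atTop_atTop)
  refine summable_of_isBigO_nat (Real.summable_nat_rpow.2 (show (-2 : ℝ) < -1 by norm_num)) ?_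
  refine h.isBigO.congr (fun n => rfl) fun n => ?_
  simp only [Function.comp]
  rw [← Real.rpow_mul (Nat.cast_nonneg n)]
  congr 1
  field_simp

end Asymptotics

end SeymourTournament

/-! ### Summable deviations and Borel–Cantelli -/

open SeymourTournament in
theorem SeymourTournament.IsRandomTournament.summable_prob_deviation {Ω : Type*} [MeasurableSpace Ω]
    {P : Measure Ω} [IsProbabilityMeasure P] {T : Ω → Digraph ℕ+} (hT : IsRandomTournament P T)
    {ε : ℝ} (hε : 0 < ε) :
    Summable fun n : ℕ => P.real {ω | |(seymourCount (T ω) n : ℝ)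
      - ∫ ω', (seymourCount (T ω') n : ℝ) ∂P| > (n : ℝ) ^ ((0.5 : ℝ) + ε)} := by
  refine summable_of_isBigO_nat ((summable_far_bound 2).add
    ((summable_exp_neg_rpow (c := 1 / 8) (δ := 2 * ε) (by norm_num) (by linarith)).mul_left 2)) ?_
  refine Asymptotics.IsBigO.of_bound 1 ?_
  -- The power 3 is the factor `n` in the difference of the means times the $n^2$ pairs. The bound
  -- `1 / 2` suffices because the threshold `a` below is at least that.
  filter_upwards [eventually_ge_atTop 1,
    (summable_far_bound 3).tendsto_atTop_zero.eventually_le_const (show (0 : ℝ) < 1 / 2 by norm_num)]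
    with n hn hsmall
  have hn' : (1 : ℝ) ≤ n := by exact_mod_cast hn
  have hfar := hT.prob_hasFarPair_le n
  have hone : (1 : ℝ) ≤ (n : ℝ) ^ ((0.5 : ℝ) + ε) := Real.one_le_rpow hn' (by positivity)
  have h := hT.prob_abs_seymourCount_sub_gt_le n (a := (n : ℝ) ^ ((0.5 : ℝ) + ε) / 2)
    (by positivity) (by
      calc (n : ℝ) * P.real {ω | HasFarPair (T ω) n} ≤ n * (n ^ 2 * (3 / 4) ^ (n - 2)) := by gcongr
        _ = n ^ 3 * (3 / 4) ^ (n - 2) := by ring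
        _ ≤ 1 / 2 := hsmall
        _ ≤ _ := by linarith)
  rw [mul_div_cancel₀ _ two_ne_zero] at h
  -- With $a = n^{1/2+\varepsilon}/2$, the constant 8 is 4 from the halving times 2 from the
  -- Gaussian tail.
  have hexp : -((n : ℝ) ^ ((0.5 : ℝ) + ε) / 2) ^ 2 / (2 * n) = -(1 / 8) * (n : ℝ) ^ (2 * ε) := by
    have : ((n : ℝ) ^ ((0.5 : ℝ) + ε)) ^ 2 = n * (n : ℝ) ^ (2 * ε) := by
      rw [← Real.rpow_natCast, ← Real.rpow_mul (by positivity),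
        show ((0.5 : ℝ) + ε) * (2 : ℕ) = 1 + 2 * ε by push_cast; ring,
        Real.rpow_add (by positivity), Real.rpow_one]
    rw [div_pow, this]
    field_simp
    norm_num
  rw [hexp] at h
  rw [one_mul, Real.norm_of_nonneg measureReal_nonneg, Real.norm_of_nonneg (by positivity)]
  linarith

theorem theorem2p4 {Ω : Type*} [MeasurableSpace Ω] (P : Measure Ω) [IsProbabilityMeasure P]
    (T : Ω → Digraph ℕ+) (hT : SeymourTournament.IsRandomTournament P T)
    (ε : ℝ) (hε : 0 < ε) :
    P {ω | ∃ᶠ n : ℕ in atTop,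
      |(SeymourTournament.seymourCount (T ω) n : ℝ)
          - ∫ ω', (SeymourTournament.seymourCount (T ω') n : ℝ) ∂P|
        > (n : ℝ) ^ ((0.5 : ℝ) + ε)} = 0 := by
  refine measure_setOfPred_frequently_eq_zero ?_
  have h := (hT.summable_prob_deviation hε).tsum_ofReal_ne_top
  simpa only [ofReal_measureReal (measure_ne_top P _)] using h
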